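/- Let $G$ be a group and $A$ a finite set. Endow $A^G$ with the prodiscrete topology and with the left shift action $(gx)(h)=x(g^{-1}h)$. A subshift is a closed shift-invariant set $X\subset A^G$. For finite $F\subset G$ let $L_F(X)\subset A^F$ be the set of patterns $(g^{-1}x)|_F$ with $x\in X$, $g\in G$. The subshift $X$ is strongly irreducible if there is a finite $K\subset G$ such that for all finite $S,T\subset G$ with $SK\cap T=\varnothing$ and all $p\in L_S(X)$, $q\in L_T(X)$ there is $x\in X$ with $x|_S=p$ and $x|_T=q$; it is faithful if $\mathbf 1_G$ is the only $g\in G$ with $gx=x$ for every $x\in X$. Let $\operatorname{Aut}(X)$ be the group, under composition, of all $G$-equivariant homeomorphisms $X\to X$, and $Z(\cdot)$ the center of a group. Let $G,H$ be infinite groups and $A,B$ finite sets. (1) Let $X\subset A^G$ and $Y\subset B^H$ be faithful strongly irreducible subshifts. If $\operatorname{Aut}(X)\cong\operatorname{Aut}(Y)$, then $Z(G)\cong Z(H)$. (2) In particular, if $\min(|A|,|B|)\ge 2$ and $\operatorname{Aut}(A^G)\cong\operatorname{Aut}(B^H)$, then $Z(G)\cong Z(H)$. (3) If $m\ne n$ are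 positive integers, then $\operatorname{Aut}(\{0,1\}^{\mathbb Z^m})$ and $\operatorname{Aut}(\{0,1\}^{\mathbb Z^n})$ are not isomorphic. -/

import Mathlib

open scoped Pointwise

namespace SymbolicDynamics.FullShift.MulSubshift

section

variable {A : Type*} [TopologicalSpace A] {G : Type*} [Group G]

/-- The left shift action `(g x)(h) = x (g⁻¹ h)` of `G` on a subshift `X ⊆ A^G`.
(`mulShift g` is the map `x ↦ (h ↦ x (g h))`, so that the left action of `g` is `mulShift g⁻¹`.) -/
def leftShift (X : MulSubshift A G) (g : G) (x : X.carrier) : X.carrier :=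
  ⟨mulShift g⁻¹ x.1, X.mapsTo g⁻¹ x.2⟩

theorem leftShift_apply (X : MulSubshift A G) (g : G) (x : X.carrier) (h : G) :
    (X.leftShift g x).1 h = x.1 (g⁻¹ * h) := rfl

theorem leftShift_one (X : MulSubshift A G) (x : X.carrier) : X.leftShift 1 x = x := by
  apply Subtype.ext
  funext h
  simp [leftShift_apply]

theorem leftShift_mul (X : MulSubshift A G) (g k : G) (x : X.carrier) :
    X.leftShift (g * k) x = X.leftShift g (X.leftShift k x) := by
  apply Subtype.ext
  funext h
  simp [leftShift_apply, mul_assoc]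

/-- `Fix(X)`: the subgroup of all `g ∈ G` which fix every point of `X`, that is, the kernel of the
shift action on `X`. -/
def Fix (X : MulSubshift A G) : Subgroup G where
  carrier := {g | ∀ x : X.carrier, X.leftShift g x = x}
  one_mem' := X.leftShift_one
  mul_mem' := by
    intro g k hg hk x
    rw [leftShift_mul, hk x, hg x]
  inv_mem' := by
    intro g hg x
    have h := X.leftShift_mul g⁻¹ g x
    rw [inv_mul_cancel, leftShift_one, hg x] at h
    exact h.symm

/-- A subshift is faithful if the shift action on it is: only the identity fixes every point. -/
def IsFaithful (X : MulSubshift A G) : Prop := X.Fix = ⊥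

/-- `L_F(X)`: the patterns `p ∈ A^F` that appear in some `x ∈ X` at some position `g ∈ G`,
which means `(g⁻¹ x)|_F = p`. -/
def patternsOn (X : MulSubshift A G) (F : Finset G) : Set (F → A) :=
  {p | ∃ (x : X.carrier) (g : G), ∀ h : F, (X.leftShift g⁻¹ x).1 h = p h}

/-- Strong irreducibility: there is a finite `K ⊆ G` such that for all finite `S, T ⊆ G` with
`SK ∩ T = ∅`, any `p ∈ L_S(X)` and `q ∈ L_T(X)` occur together, as `x|_S = p` and `x|_T = q` for
some `x ∈ X`. -/
def IsStronglyIrreducible (X : MulSubshift A G) : Prop :=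
  ∃ K : Finset G, ∀ S T : Finset G, Disjoint ((S : Set G) * (K : Set G)) (T : Set G) →
    ∀ p ∈ X.patternsOn S, ∀ q ∈ X.patternsOn T,
      ∃ x : X.carrier, (∀ h : S, x.1 h = p h) ∧ ∀ h : T, x.1 h = q h

/-- `Aut(X)`: the group, under composition, of all `G`-equivariant homeomorphisms `X → X`. -/
def Aut (X : MulSubshift A G) : Subgroup (X.carrier ≃ₜ X.carrier) where
  carrier := {φ | ∀ (g : G) (x : X.carrier), φ (X.leftShift g x) = X.leftShift g (φ x)}
  one_mem' := fun _ _ => rfl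
  mul_mem' := by
    intro φ ψ hφ hψ g x
    rw [Homeomorph.mul_apply, Homeomorph.mul_apply, hψ g x, hφ g (ψ x)]
  inv_mem' := by
    intro φ hφ g x
    apply φ.injective
    rw [hφ g]
    simp [Homeomorph.inv_apply]

end

end SymbolicDynamics.FullShift.MulSubshift

open SymbolicDynamics.FullShift

universe u v w z

/-! This is Ryan's theorem: `Z(Aut X)` consists exactly of the shifts by elements of `Z(G)`, so `Aut
X` determines `Z(G)`. The full shift on at least two letters is faithful and strongly irreducible,
and `ℤ^m` is its own center with rank `m`.

Suppose a central `φ` is not a shift. By `exists_finset_forall_apply_ne` some pattern on a finite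
`F` prevents `φ` from acting as the shift by any `g` in a prescribed finite set. `exists_markerPair`
extends it to two points `y₀`, `y₁` that differ only on `K` and whose occurrences cannot overlap.
Swapping the two patterns wherever they occur is an automorphism, so it commutes with `φ`. Since `φ
y₀` and `φ y₁` differ somewhere, the swap must change `φ y₀` there; hence a marker occurs in `φ y₀`
at some `g` of the prescribed set. On `F`, `φ` then looks like the shift by `g`, a contradiction.

Markers exist by counting (`exists_marker`): overlapping itself along one fixed translate is
exponentially rare in `r`, while only quadratically many translates in `r` must be excluded. -/

namespace SymbolicDynamics.FullShift.MulSubshift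

/-! ### Gluing, compactness and finite memory -/

section Basic

variable {A : Type*} [TopologicalSpace A] {G : Type*} [Group G]

/-- Points of `X` can be glued along finite sets `S`, `T` as soon as `S K` and `T` are disjoint. -/
def GluesWith (X : MulSubshift A G) (K : Finset G) : Prop :=
  ∀ S T : Finset G, (∀ s ∈ S, ∀ k ∈ K, s * k ∉ T) → ∀ x y : X.carrier,
    ∃ z : X.carrier, (∀ h ∈ S, z.1 h = x.1 h) ∧ ∀ h ∈ T, z.1 h = y.1 h

theorem IsStronglyIrreducible.exists_gluesWith {X : MulSubshift A G}
    (hX : X.IsStronglyIrreducible) : ∃ K : Finset G, 1 ∈ K ∧ X.GluesWith K := by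
  classical
  obtain ⟨K, hK⟩ := hX
  refine ⟨insert 1 K, Finset.mem_insert_self _ _, fun S T hST x y => ?_⟩
  have key : ∀ (F : Finset G) (x : X.carrier), (fun h : F => x.1 h) ∈ X.patternsOn F := by
    intro F x
    refine ⟨x, 1, fun h => ?_⟩
    simp [leftShift_apply]
  obtain ⟨z, hz1, hz2⟩ := hK S T (by
    rw [Set.disjoint_left]
    rintro _ ⟨s, hs, k, hk, rfl⟩ ht
    exact hST s hs k (Finset.mem_insert_of_mem hk) ht) _ (key S x) _ (key T y)
  exact ⟨z, fun h hh => hz1 ⟨h, hh⟩, fun h hh => hz2 ⟨h, hh⟩⟩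

theorem mem_carrier_of_forall_finset [DiscreteTopology A] (X : MulSubshift A G) (y : G → A)
    (h : ∀ F : Finset G, ∃ z ∈ X.carrier, ∀ t ∈ F, z t = y t) : y ∈ X.carrier := by
  rw [← X.isClosed.closure_eq, mem_closure_iff]
  intro o ho hy
  obtain ⟨I, u, hu, hsub⟩ := isOpen_pi_iff.1 ho y hy
  obtain ⟨z, hz, hzy⟩ := h I
  exact ⟨z, hsub fun a ha => by rw [hzy a ha]; exact (hu a ha).2, hz⟩

/-- `(φ x)(g)` only depends on the restriction of `x` to `g m`. -/
def HasMemory (X : MulSubshift A G) (φ : X.carrier → X.carrier) (m : Finset G) : Prop :=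
  ∀ (g : G) (x y : X.carrier), (∀ t ∈ m, x.1 (g * t) = y.1 (g * t)) → (φ x).1 g = (φ y).1 g

theorem hasMemory_id (X : MulSubshift A G) : X.HasMemory id {1} := by
  intro g x y h
  simpa using h 1 (by simp)

/-- Curtis–Hedlund–Lyndon: continuity gives each point a finite window, and compactness leaves
finitely many cylinders, whose windows are united. -/
theorem exists_finset_determines [Finite A] [DiscreteTopology A] (X : MulSubshift A G)
    {f : X.carrier → A} (hf : Continuous f) :
    ∃ m : Finset G, ∀ x y : X.carrier, (∀ t ∈ m, x.1 t = y.1 t) → f x = f y := by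
  classical
  have hloc : ∀ x : X.carrier, ∃ I : Finset G, ∀ y : X.carrier,
      (∀ t ∈ I, y.1 t = x.1 t) → f y = f x := by
    intro x
    obtain ⟨V, hV, hVf⟩ := isOpen_induced_iff.1 ((isOpen_discrete {f x}).preimage hf)
    have hx : x.1 ∈ V := by
      have : x ∈ Subtype.val ⁻¹' V := by rw [hVf]; rfl
      exact this
    obtain ⟨I, u, hu, hsub⟩ := isOpen_pi_iff.1 hV x.1 hx
    refine ⟨I, fun y hy => ?_⟩
    have : y ∈ Subtype.val ⁻¹' V := hsub fun a ha => by rw [hy a ha]; exact (hu a ha).2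
    rw [hVf] at this
    exact this
  choose I hI using hloc
  have : CompactSpace X.carrier := isCompact_iff_compactSpace.1 X.isClosed.isCompact
  obtain ⟨t, ht⟩ := isCompact_univ.elim_nhds_subcover
    (fun x : X.carrier => Subtype.val ⁻¹' cylinder (I x) x.1) (fun x _ =>
      ((isOpen_cylinder (I x) x.1).preimage continuous_subtype_val).mem_nhds
        (fun _ _ => rfl))
  refine ⟨t.biUnion I, fun x y hxy => ?_⟩
  have hx := ht.2 (Set.mem_univ x)
  simp only [Set.mem_iUnion] at hx
  obtain ⟨p, hp, hxp⟩ := hx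
  rw [hI p x hxp, hI p y]
  intro s hs
  rw [← hxy s (Finset.mem_biUnion.2 ⟨p, hp, hs⟩)]
  exact hxp s hs

theorem exists_hasMemory [Finite A] [DiscreteTopology A] (X : MulSubshift A G)
    {φ : X.carrier → X.carrier} (hφ : Continuous φ)
    (hφG : ∀ (g : G) (x : X.carrier), φ (X.leftShift g x) = X.leftShift g (φ x)) :
    ∃ m : Finset G, X.HasMemory φ m := by
  obtain ⟨m, hm⟩ := X.exists_finset_determines
    ((continuous_apply (1 : G)).comp (continuous_subtype_val.comp hφ))
  refine ⟨m, fun g x y hxy => ?_⟩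
  have := hm (X.leftShift g⁻¹ x) (X.leftShift g⁻¹ y) (by simpa [leftShift_apply] using hxy)
  simpa [hφG, leftShift_apply] using this

theorem continuous_of_determines [Finite A] [DiscreteTopology A] (X : MulSubshift A G)
    {φ : X.carrier → X.carrier}
    (h : ∀ g : G, ∃ m : Finset G, ∀ x y : X.carrier, (∀ t ∈ m, x.1 t = y.1 t) →
      (φ x).1 g = (φ y).1 g) : Continuous φ := by
  refine Continuous.subtype_mk (continuous_pi fun g => ?_) _
  obtain ⟨m, hm⟩ := h g
  refine IsLocallyConstant.continuous ((IsLocallyConstant.iff_exists_open _).2 fun x => ?_)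
  exact ⟨Subtype.val ⁻¹' cylinder m x.1,
    (isOpen_cylinder m x.1).preimage continuous_subtype_val, fun _ _ => rfl,
    fun y hy => hm y x hy⟩

/-- Otherwise, by shift invariance, all points agree everywhere, and every group element fixes `X`.
-/
theorem exists_apply_one_ne [Infinite G] {X : MulSubshift A G} (hX : X.IsFaithful) :
    ∃ u v : X.carrier, u.1 1 ≠ v.1 1 := by
  by_contra! hcon
  obtain ⟨g, hg⟩ := exists_ne (1 : G)
  have hfix : g ∈ X.Fix := by
    intro x
    apply Subtype.ext
    funext h
    have := hcon (X.leftShift (h⁻¹ * g) x) (X.leftShift h⁻¹ x)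
    simpa [leftShift_apply] using this
  rw [show X.Fix = ⊥ from hX, Subgroup.mem_bot] at hfix
  exact hg hfix

/-- Whenever `φ` is not the shift by `k`, this is witnessed in a finite set independent of `k`. -/
theorem exists_finset_apply_ne {X : MulSubshift A G} {K : Finset G} (hK : X.GluesWith K)
    (hne : ∃ u v : X.carrier, u.1 1 ≠ v.1 1) {φ : X.carrier → X.carrier} {m : Finset G}
    (hφ : X.HasMemory φ m) :
    ∃ J : Finset G, ∀ k : G, (∃ (j : G) (x : X.carrier), (φ x).1 (k * j) ≠ x.1 j) →
      ∃ j ∈ J, ∃ x : X.carrier, (φ x).1 (k * j) ≠ x.1 j := by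
  classical
  obtain ⟨u, v, huv⟩ := hne
  have hex : ∀ k : G, ∃ j : G, (∃ (j : G) (x : X.carrier), (φ x).1 (k * j) ≠ x.1 j) →
      ∃ x : X.carrier, (φ x).1 (k * j) ≠ x.1 j := by
    intro k
    by_cases h : ∃ (j : G) (x : X.carrier), (φ x).1 (k * j) ≠ x.1 j
    · obtain ⟨j, hj⟩ := h
      exact ⟨j, fun _ => hj⟩
    · exact ⟨1, fun h' => absurd h' h⟩
  choose J hJ using hex
  -- For `k` outside the finite set `K m⁻¹`, the window `k m` avoids `K`, so the letter at `1` can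
  -- be chosen independently of `(φ x)(k)` and `j = 1` works.
  refine ⟨insert 1 ((K * m⁻¹).image J), fun k hk => ?_⟩
  by_cases hkK : k ∈ K * m⁻¹
  · exact ⟨J k, Finset.mem_insert_of_mem (Finset.mem_image_of_mem _ hkK), hJ k hk⟩
  · refine ⟨1, Finset.mem_insert_self _ _, ?_⟩
    obtain ⟨w, hw⟩ : ∃ w : X.carrier, (φ u).1 k ≠ w.1 1 := by
      by_cases h : (φ u).1 k = u.1 1
      · exact ⟨v, h ▸ huv⟩
      · exact ⟨u, h⟩
    obtain ⟨z, hz1, hz2⟩ := hK {1} (m.image (k * ·)) (by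
      intro s hs c hc hmem
      obtain ⟨t, ht, htc⟩ := Finset.mem_image.1 hmem
      rw [Finset.mem_singleton.1 hs, one_mul] at htc
      exact hkK (Finset.mem_mul.2 ⟨c, hc, t⁻¹, Finset.inv_mem_inv ht, by rw [← htc]; simp⟩)) w u
    refine ⟨z, ?_⟩
    rw [mul_one, hφ k z u fun t ht => hz2 _ (Finset.mem_image_of_mem _ ht),
      hz1 1 (Finset.mem_singleton_self _)]
    exact hw

end Basic

/-! ### Counting estimates -/

section Counting

theorem exists_quadratic_mul_pow_lt (a b d C : ℕ) :
    ∃ r : ℕ, d * (a * r + b) ^ 2 * C ^ r < (C + 1) ^ r := by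
  have hq : (C : ℝ) / (C + 1) < 1 := by
    rw [div_lt_one (by positivity)]
    linarith
  have h := (tendsto_pow_const_mul_const_pow_of_lt_one 2
    (by positivity : (0 : ℝ) ≤ (C : ℝ) / (C + 1)) hq).const_mul ((d : ℝ) * (a + b) ^ 2)
  rw [mul_zero] at h
  obtain ⟨r, hr1, hr⟩ := ((Filter.eventually_ge_atTop 1).and
    (h.eventually (gt_mem_nhds (zero_lt_one' ℝ)))).exists
  refine ⟨r, ?_⟩
  have hr1' : (1 : ℝ) ≤ r := by exact_mod_cast hr1
  have hlin : (a * r + b : ℝ) ≤ (a + b) * r := by nlinarith [Nat.cast_nonneg (α := ℝ) b]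
  have hsq : (a * r + b : ℝ) ^ 2 ≤ ((a + b) * r) ^ 2 := by gcongr
  have hpos : (0 : ℝ) < (C + 1 : ℝ) ^ r := by positivity
  rw [div_pow, ← mul_div_assoc, ← mul_div_assoc, div_lt_one hpos] at hr
  have : (d * (a * r + b) ^ 2 * C ^ r : ℝ) < (C + 1 : ℝ) ^ r := by
    refine lt_of_le_of_lt ?_ hr
    calc (d * (a * r + b) ^ 2 * C ^ r : ℝ) ≤ d * ((a + b) * r) ^ 2 * C ^ r := by gcongr
      _ = _ := by ring
  exact_mod_cast this

/-- If every word of `W'` can be moved from `W'` to the rest of `W` by changing only letters in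
`V`, then `W'` is smaller than `W` by a factor depending only on a bound for the size of `V`. -/
theorem ncard_mul_succ_le {ι A : Type*} [Finite ι] [Finite A] [Nonempty A] {W W' : Set (ι → A)}
    (hW : W' ⊆ W) (V : Set ι) (c : ℕ) (hc : V.ncard ≤ c)
    (h : ∀ w ∈ W', ∃ w' ∈ W, w' ∉ W' ∧ ∀ i ∉ V, w' i = w i) :
    W'.ncard * (Nat.card A ^ c + 1) ≤ W.ncard * Nat.card A ^ c := by
  classical
  cases nonempty_fintype ι
  cases nonempty_fintype A
  have h' : ∀ w, ∃ w', w ∈ W' → w' ∈ W ∧ w' ∉ W' ∧ ∀ i ∉ V, w' i = w i := by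
    intro w
    by_cases hw : w ∈ W'
    · obtain ⟨w', h1, h2⟩ := h w hw
      exact ⟨w', fun _ => ⟨h1, h2⟩⟩
    · exact ⟨w, fun h => absurd h hw⟩
  choose f hf using h'
  -- A word is recovered from its image under `f` and its letters on `V`, so the fibres have at most
  -- `|A|^c` elements.
  have hle : W'.toFinset.card ≤ Nat.card A ^ c * (W \ W').toFinset.card := by
    refine Finset.card_le_mul_card_image_of_maps_to (f := f) (fun w hw => ?_) _ fun b _ => ?_
    · have := hf w (by simpa using hw)
      simp [this.1, this.2.1]
    · have hinj : Set.InjOn (fun (w : ι → A) (i : V.toFinset) => w i)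
          (W'.toFinset.filter fun w => f w = b : Finset (ι → A)) := by
        intro w hw w' hw' hww
        simp only [Finset.coe_filter, Set.mem_toFinset, Set.mem_ofPred_eq] at hw hw'
        funext i
        by_cases hi : i ∈ V
        · exact congrFun hww ⟨i, by simpa using hi⟩
        · rw [← (hf w hw.1).2.2 i hi, ← (hf w' hw'.1).2.2 i hi, hw.2, hw'.2]
      have := Finset.card_le_card_of_injOn (t := Finset.univ) _ (fun _ _ => Finset.mem_univ _) hinj
      refine this.trans ?_
      rw [Finset.card_univ, Fintype.card_fun, Fintype.card_coe, Nat.card_eq_fintype_card]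
      refine Nat.pow_le_pow_right Fintype.card_pos ?_
      rwa [← Set.ncard_eq_toFinset_card']
  rw [← Set.ncard_eq_toFinset_card', ← Set.ncard_eq_toFinset_card'] at hle
  have hsum := Set.ncard_sdiff_add_ncard_of_subset hW
  calc W'.ncard * (Nat.card A ^ c + 1) = Nat.card A ^ c * W'.ncard + W'.ncard := by ring
    _ ≤ Nat.card A ^ c * W'.ncard + Nat.card A ^ c * (W \ W').ncard := by gcongr
    _ = _ := by rw [← hsum]; ring

end Counting

/-! ### Exchangeable fillings -/

section Replace

variable {A : Type*} {G : Type*}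

open Classical in
/-- The configuration which is `y` on `D` and `x` elsewhere. -/
noncomputable def replaceOn (D : Finset G) (y x : G → A) : G → A :=
  fun h => if h ∈ D then y h else x h

theorem replaceOn_of_mem {D : Finset G} {y x : G → A} {h : G} (hh : h ∈ D) :
    replaceOn D y x h = y h := if_pos hh

theorem replaceOn_of_notMem {D : Finset G} {y x : G → A} {h : G} (hh : h ∉ D) :
    replaceOn D y x h = x h := if_neg hh

end Replace

section Exchange

variable {A : Type*} [TopologicalSpace A] {G : Type*} [Group G]

/-- Each pattern outside `D` extends to one which frames `D` so tightly that all its fillings of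
`D` can be exchanged freely. -/
theorem exists_exchangeable [Finite A] [DiscreteTopology A] (X : MulSubshift A G)
    (D F : Finset G) (x₀ : X.carrier) :
    ∃ (T : Finset G) (x₁ : X.carrier), F ⊆ T ∧ D ⊆ T ∧ (∀ h ∈ F, h ∉ D → x₁.1 h = x₀.1 h) ∧
      ∀ x y : X.carrier, (∀ h ∈ T, h ∉ D → x.1 h = x₁.1 h) →
        (∀ h ∈ T, h ∉ D → y.1 h = x₁.1 h) → replaceOn D y.1 x.1 ∈ X.carrier := by
  classical
  let E : Finset G → X.carrier → Set (D → A) := fun T x₁ =>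
    (fun (y : X.carrier) (h : D) => y.1 h) '' {y | ∀ h ∈ T, h ∉ D → y.1 h = x₁.1 h}
  -- Choose the frame with the fewest fillings of `D`. Enlarging it can then lose none, so the
  -- filling of `y` fits `x` on every finite set, and `X` is closed.
  have hex : ∃ (n : ℕ) (T : Finset G) (x₁ : X.carrier), F ⊆ T ∧ D ⊆ T ∧
      (∀ h ∈ F, h ∉ D → x₁.1 h = x₀.1 h) ∧ (E T x₁).ncard = n :=
    ⟨_, F ∪ D, x₀, Finset.subset_union_left, Finset.subset_union_right, fun _ _ _ => rfl, rfl⟩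
  obtain ⟨T, x₁, hF, hD, hx₁, hn⟩ := Nat.find_spec hex
  refine ⟨T, x₁, hF, hD, hx₁, fun x y hx hy => ?_⟩
  refine X.mem_carrier_of_forall_finset _ fun T' => ?_
  have hsub : E (T ∪ T') x ⊆ E T x₁ := by
    rintro _ ⟨z, hz, rfl⟩
    exact ⟨z, fun h hh hD => by rw [hz h (Finset.mem_union_left _ hh) hD, hx h hh hD], rfl⟩
  have hmin : (E T x₁).ncard ≤ (E (T ∪ T') x).ncard := by
    rw [hn]
    exact Nat.find_min' hex ⟨T ∪ T', x, hF.trans Finset.subset_union_left,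
      hD.trans Finset.subset_union_left, fun h hh hD => by rw [hx h (hF hh) hD, hx₁ h hh hD], rfl⟩
  have hmem : (fun h : D => y.1 h) ∈ E (T ∪ T') x := by
    rw [Set.eq_of_subset_of_ncard_le hsub hmin (Set.toFinite _)]
    exact ⟨y, hy, rfl⟩
  obtain ⟨z, hz, hzy⟩ := hmem
  refine ⟨z.1, z.2, fun t ht => ?_⟩
  by_cases hD : t ∈ D
  · rw [replaceOn_of_mem hD]
    exact congrFun hzy ⟨t, hD⟩
  · rw [replaceOn_of_notMem hD]
    exact hz t (Finset.mem_union_right _ ht) hD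

end Exchange

/-! ### Non-overlapping markers -/

section Marker

variable {A : Type*} [TopologicalSpace A] {G : Type*} [Group G]

/-- The restrictions to `M` of the points in `P`. -/
def words (X : MulSubshift A G) (M : Finset G) (P : Set X.carrier) : Set (M → A) :=
  (fun (x : X.carrier) (i : M) => x.1 i) '' P

theorem words_mono (X : MulSubshift A G) (M : Finset G) {P Q : Set X.carrier} (h : P ⊆ Q) :
    X.words M P ⊆ X.words M Q := Set.image_mono h

/-- Agreement with the translate by `h` on a suitable set of `r` positions is exponentially rare. -/
theorem exists_rare_agreement [DecidableEq G] [Finite A] [Nonempty A] {X : MulSubshift A G}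
    {K : Finset G} (h1K : 1 ∈ K) (hK : X.GluesWith K) {T M J Z : Finset G} (hTM : T ⊆ M) (x₁ : X.carrier) (h : G)
    (hZ : ∀ t ∈ Z, ∀ j ∈ J, t * j ∈ M ∧ h⁻¹ * (t * j) ∈ M)
    (hJ : ∀ t : G, ∃ j ∈ J, ∃ u : X.carrier, u.1 (h⁻¹ * (t * j)) ≠ u.1 (t * j)) (r : ℕ)
    (hr : 2 * (J.card * (K.card * (2 * r + T.card))) < Z.card) :
    ∃ U : Finset G, U.card ≤ r ∧ (∀ s ∈ U, s ∈ M \ T ∧ h⁻¹ * s ∈ M \ T) ∧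
      (X.words M {x | (∀ t ∈ T, x.1 t = x₁.1 t) ∧ ∀ s ∈ U, x.1 s = x.1 (h⁻¹ * s)}).ncard *
          (Nat.card A ^ (2 * K.card) + 1) ^ r ≤
        (X.words M {x | ∀ t ∈ T, x.1 t = x₁.1 t}).ncard * (Nat.card A ^ (2 * K.card)) ^ r := by
  classical
  induction r with
  | zero => exact ⟨∅, by simp, by simp, by simp⟩
  | succ r ih =>
    have hrr : 2 * (J.card * (K.card * (2 * r + T.card))) ≤
        2 * (J.card * (K.card * (2 * (r + 1) + T.card))) := by gcongr; omega
    obtain ⟨U, hUc, hUM, hU⟩ := ih (hrr.trans_lt hr)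
    -- `B` holds the positions already constrained. The next `s` needs `s K` and `h⁻¹ s K` to miss
    -- `B`, that is, `s` and `h⁻¹ s` outside `F = B K⁻¹`; the size of `Z` leaves room for this.
    set B : Finset G := T ∪ (U ∪ U.image (h⁻¹ * ·)) with hB
    have hBc : B.card ≤ 2 * r + T.card := by
      rw [hB]
      have h1 := Finset.card_union_le T (U ∪ U.image (h⁻¹ * ·))
      have h2 := Finset.card_union_le U (U.image (h⁻¹ * ·))
      have h3 : (U.image (h⁻¹ * ·)).card ≤ U.card := Finset.card_image_le
      omega
    have hBM : B ⊆ M := by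
      intro b hb
      simp only [hB, Finset.mem_union, Finset.mem_image] at hb
      rcases hb with hb | hb | ⟨s, hs, rfl⟩
      · exact hTM hb
      · exact (Finset.mem_sdiff.1 (hUM b hb).1).1
      · exact (Finset.mem_sdiff.1 (hUM s hs).2).1
    set F : Finset G := B * K⁻¹ with hF
    have hFc : F.card ≤ K.card * (2 * r + T.card) := by
      refine Finset.card_mul_le.trans ?_
      rw [Finset.card_inv, mul_comm]
      gcongr
    obtain ⟨t, htZ, ht⟩ : ∃ t ∈ Z, t ∉ F * J⁻¹ ∪ (F.image (h * ·)) * J⁻¹ := by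
      refine Finset.exists_mem_notMem_of_card_lt_card ((Finset.card_union_le _ _).trans_lt ?_)
      have h1 : (F * J⁻¹).card ≤ F.card * J.card := by
        simpa using Finset.card_mul_le (s := F) (t := J⁻¹)
      have h2 : (F.image (h * ·) * J⁻¹).card ≤ F.card * J.card := by
        refine (Finset.card_mul_le).trans ?_
        rw [Finset.card_inv]
        exact Nat.mul_le_mul_right _ Finset.card_image_le
      have h3 : F.card * J.card ≤ J.card * (K.card * (2 * r + T.card)) := by
        rw [mul_comm]; gcongr
      omega
    obtain ⟨j, hjJ, u, hu⟩ := hJ t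
    set s := t * j with hs
    have hsF : s ∉ F := fun hsF => ht (Finset.mem_union_left _
      (Finset.mem_mul.2 ⟨s, hsF, j⁻¹, Finset.inv_mem_inv hjJ, by simp [hs]⟩))
    have hsF' : h⁻¹ * s ∉ F := fun hsF => ht (Finset.mem_union_right _
      (Finset.mem_mul.2 ⟨s, Finset.mem_image.2 ⟨_, hsF, by simp⟩, j⁻¹,
        Finset.inv_mem_inv hjJ, by simp [hs]⟩))
    have hBF : ∀ g : G, g ∉ F → ∀ k ∈ K, g * k ∉ B := fun g hg k hk hgk =>
      hg (Finset.mem_mul.2 ⟨g * k, hgk, k⁻¹, Finset.inv_mem_inv hk, by simp⟩)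
    have hsM := hZ t htZ j hjJ
    rw [← hs] at hsM
    have hsB : s ∉ B := by simpa using hBF s hsF 1 h1K
    have hsB' : h⁻¹ * s ∉ B := by simpa using hBF _ hsF' 1 h1K
    have hsT : s ∉ T := fun h => hsB (Finset.mem_union_left _ h)
    have hsT' : h⁻¹ * s ∉ T := fun h => hsB' (Finset.mem_union_left _ h)
    refine ⟨insert s U, (Finset.card_insert_le _ _).trans (by omega), ?_, ?_⟩
    · intro s' hs'
      rcases Finset.mem_insert.1 hs' with rfl | hs'
      · exact ⟨Finset.mem_sdiff.2 ⟨hsM.1, hsT⟩, Finset.mem_sdiff.2 ⟨hsM.2, hsT'⟩⟩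
      · exact hUM s' hs'
    set S : Finset G := {s, h⁻¹ * s} with hS
    have hstep := ncard_mul_succ_le
      (W := X.words M {x | (∀ t ∈ T, x.1 t = x₁.1 t) ∧ ∀ s ∈ U, x.1 s = x.1 (h⁻¹ * s)})
      (W' := X.words M {x | (∀ t ∈ T, x.1 t = x₁.1 t) ∧
        ∀ s' ∈ insert s U, x.1 s' = x.1 (h⁻¹ * s')})
      (X.words_mono M fun x hx => ⟨hx.1, fun s' hs' => hx.2 s' (Finset.mem_insert_of_mem hs')⟩)
      {i : M | i.1 ∈ S * K} (2 * K.card) (by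
        calc Set.ncard {i : M | i.1 ∈ S * K} ≤ (S * K : Finset G).card := by
              rw [← Set.ncard_coe_finset (S * K)]
              exact Set.ncard_le_ncard_of_injOn Subtype.val (fun i hi => hi)
                Subtype.val_injective.injOn
          _ ≤ S.card * K.card := Finset.card_mul_le
          _ ≤ 2 * K.card := by gcongr; exact Finset.card_le_two) (by
        rintro _ ⟨x, hx, rfl⟩
        -- Gluing in `u` breaks the agreement at `s`, alters letters of `M` only in `S K`, and
        -- leaves `B` untouched.
        obtain ⟨y, hyS, hyM⟩ := hK S (M \ (S * K)) (fun a ha k hk hak =>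
          (Finset.mem_sdiff.1 hak).2 (Finset.mul_mem_mul ha hk)) u x
        have hyB : ∀ b ∈ B, y.1 b = x.1 b := by
          intro b hb
          refine hyM b (Finset.mem_sdiff.2 ⟨hBM hb, fun hbS => ?_⟩)
          obtain ⟨a, ha, k, hk, rfl⟩ := Finset.mem_mul.1 hbS
          rcases Finset.mem_insert.1 ha with rfl | ha
          · exact hBF _ hsF k hk hb
          · rw [Finset.mem_singleton.1 ha] at hb
            exact hBF _ hsF' k hk hb
        refine ⟨_, ⟨y, ⟨fun t' ht' => ?_, fun s' hs' => ?_⟩, rfl⟩, ?_, fun i hi => ?_⟩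
        · rw [hyB t' (Finset.mem_union_left _ ht'), hx.1 t' ht']
        · rw [hyB s' (Finset.mem_union_right _ (Finset.mem_union_left _ hs')),
            hyB (h⁻¹ * s') (Finset.mem_union_right _ (Finset.mem_union_right _
              (Finset.mem_image_of_mem _ hs'))), hx.2 s' (Finset.mem_insert_of_mem hs')]
        · rintro ⟨x', hx', hxy⟩
          have e1 : x'.1 s = y.1 s := congrFun hxy ⟨s, hsM.1⟩
          have e2 : x'.1 (h⁻¹ * s) = y.1 (h⁻¹ * s) := congrFun hxy ⟨h⁻¹ * s, hsM.2⟩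
          apply hu
          rw [← hyS s (by simp [hS]), ← hyS (h⁻¹ * s) (by simp [hS]), ← e1, ← e2,
            hx'.2 s (Finset.mem_insert_self _ _)]
        · exact hyM i (Finset.mem_sdiff.2 ⟨i.2, hi⟩))
    set C := Nat.card A ^ (2 * K.card)
    calc _ = _ * (C + 1) * (C + 1) ^ r := by rw [pow_succ]; ring
      _ ≤ _ * C * (C + 1) ^ r := Nat.mul_le_mul_right _ hstep
      _ = _ * (C + 1) ^ r * C := by ring
      _ ≤ _ * C ^ r * C := Nat.mul_le_mul_right _ hU
      _ = _ := by rw [pow_succ]; ring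

/-- Every pattern of `X` extends to a marker: a pattern which does not overlap its own translates
by elements of `R M⁻¹`, not even when the original pattern is disregarded. -/
theorem exists_marker [DecidableEq G] [Infinite G] [Finite A] {X : MulSubshift A G}
    (hX : X.IsFaithful) {K : Finset G} (h1K : 1 ∈ K) (hK : X.GluesWith K) (R T : Finset G)
    (x₁ : X.carrier) :
    ∃ (M : Finset G) (x₂ : X.carrier), T ⊆ M ∧ (∀ t ∈ T, x₂.1 t = x₁.1 t) ∧
      ∀ r ∈ R, ∀ m ∈ M, r ≠ m → ∃ t ∈ M \ T, (r * m⁻¹)⁻¹ * t ∈ M \ T ∧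
        x₂.1 t ≠ x₂.1 ((r * m⁻¹)⁻¹ * t) := by
  classical
  have : Nonempty A := ⟨x₁.1 1⟩
  obtain ⟨J₀, hJ₀⟩ := exists_finset_apply_ne hK (exists_apply_one_ne hX) X.hasMemory_id
  set J := insert 1 J₀ with hJ
  have hJne : ∀ h : G, h ≠ 1 → ∀ t : G, ∃ j ∈ J, ∃ u : X.carrier,
      u.1 (h⁻¹ * (t * j)) ≠ u.1 (t * j) := by
    intro h hh t
    -- Conjugating by `t` moves the question to the origin; `J₀` serves all conjugates at once.
    obtain ⟨j, hj, u, hu⟩ := hJ₀ (t⁻¹ * h⁻¹ * t) (by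
      by_contra! hcon
      apply hh
      have hfix : t⁻¹ * h * t ∈ X.Fix := by
        intro x
        apply Subtype.ext
        funext j
        have := hcon j x
        simpa [leftShift_apply, mul_assoc] using this
      rw [show X.Fix = ⊥ from hX, Subgroup.mem_bot] at hfix
      rw [mul_assoc, inv_mul_eq_one] at hfix
      exact right_eq_mul.1 hfix)
    refine ⟨j, Finset.mem_insert_of_mem hj, X.leftShift t u, ?_⟩
    simpa [leftShift_apply, mul_assoc] using hu
  set E : Finset G := insert 1 (T ∪ R * J⁻¹) with hE
  set c := J.card * K.card
  set C := Nat.card A ^ (2 * K.card) with hC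
  obtain ⟨r, hr⟩ := exists_quadratic_mul_pow_lt (8 * c) (4 * c * T.card + 3)
    (R.card * (E.card * J.card)) C
  obtain ⟨N₀, hN₀⟩ := Infinite.exists_subset_card_eq G (4 * c * r + 2 * c * T.card + 1)
  set N : Finset G := insert 1 (N₀ ∪ N₀⁻¹) with hN
  have h1N : (1 : G) ∈ N := Finset.mem_insert_self _ _
  have hNinv : ∀ n ∈ N, n⁻¹ ∈ N := by
    intro n hn
    simp only [hN, Finset.mem_insert, Finset.mem_union, Finset.mem_inv'] at hn ⊢
    rcases hn with rfl | hn | hn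
    · simp
    · simp [hn]
    · simp [hn]
  have hNc : N.card ≤ 8 * c * r + (4 * c * T.card + 3) := by
    have h1 := Finset.card_insert_le (1 : G) (N₀ ∪ N₀⁻¹)
    have h2 := Finset.card_union_le N₀ N₀⁻¹
    rw [Finset.card_inv] at h2
    rw [← hN] at h1
    linarith
  have hN₀N : N₀.card ≤ N.card :=
    Finset.card_le_card fun n hn => Finset.mem_insert_of_mem (Finset.mem_union_left _ hn)
  -- With two factors `N`, every `h = a m'⁻¹`, `m' = e n n' j`, has a large overlap: `a j⁻¹ n'⁻¹ N
  -- J` and its `h⁻¹`-translate `e n N J` both lie in `M`. Still `|M|` is only quadratic in `|N|`,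
  -- hence in `r`.
  set M : Finset G := E * N * N * J with hM
  have hMmem : ∀ e ∈ E, ∀ n ∈ N, ∀ n' ∈ N, ∀ j ∈ J, e * n * n' * j ∈ M :=
    fun e he n hn n' hn' j hj =>
      Finset.mul_mem_mul (Finset.mul_mem_mul (Finset.mul_mem_mul he hn) hn') hj
  have hTM : T ⊆ M := by
    intro t ht
    have := hMmem t (by simp [hE, ht]) 1 h1N 1 h1N 1 (Finset.mem_insert_self _ _)
    simpa using this
  have hMc : M.card ≤ E.card * J.card * (8 * c * r + (4 * c * T.card + 3)) ^ 2 := by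
    calc M.card ≤ E.card * N.card * N.card * J.card := by
          refine Finset.card_mul_le.trans (Nat.mul_le_mul_right _ ?_)
          refine Finset.card_mul_le.trans (Nat.mul_le_mul_right _ ?_)
          exact Finset.card_mul_le
      _ = E.card * J.card * N.card ^ 2 := by ring
      _ ≤ _ := by gcongr
  set W := X.words M {x | ∀ t ∈ T, x.1 t = x₁.1 t} with hW
  let bad : G → Set (M → A) := fun h => X.words M {x | (∀ t ∈ T, x.1 t = x₁.1 t) ∧
    ∀ t ∈ M \ T, h⁻¹ * t ∈ M \ T → x.1 t = x.1 (h⁻¹ * t)}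
  set H : Finset G := (R * M⁻¹).erase 1 with hH
  have hbad : ∀ h ∈ H, (bad h).ncard * (C + 1) ^ r ≤ W.ncard * C ^ r := by
    intro h hh
    obtain ⟨hh1, hh⟩ := Finset.mem_erase.1 hh
    obtain ⟨a, ha, m', hm', hhm⟩ := Finset.mem_mul.1 hh
    rw [Finset.mem_inv'] at hm'
    obtain ⟨_, hp₁, j, hj, hmj⟩ := Finset.mem_mul.1 hm'
    obtain ⟨_, hp₂, n', hn', rfl⟩ := Finset.mem_mul.1 hp₁
    obtain ⟨e, he, n, hn, rfl⟩ := Finset.mem_mul.1 hp₂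
    have hz : h⁻¹ * (a * j⁻¹ * n'⁻¹) = e * n := by
      rw [← hhm, mul_inv_rev, ← hmj]
      group
    obtain ⟨U, -, hUM, hU⟩ := exists_rare_agreement h1K hK hTM x₁ h
      (Z := N.image (a * j⁻¹ * n'⁻¹ * ·)) (J := J) (by
        intro t ht i hi
        obtain ⟨p, hp, rfl⟩ := Finset.mem_image.1 ht
        refine ⟨hMmem _ ?_ _ (hNinv _ hn') _ hp _ hi, ?_⟩
        · exact Finset.mem_insert_of_mem (Finset.mem_union_right _
            (Finset.mul_mem_mul ha (Finset.inv_mem_inv hj)))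
        · rw [← mul_assoc, ← mul_assoc, hz]
          exact hMmem _ he _ hn _ hp _ hi) (hJne h hh1) r (by
        rw [Finset.card_image_of_injective _ (mul_right_injective _)]
        refine lt_of_lt_of_le ?_ hN₀N
        rw [hN₀]
        have : 2 * (J.card * (K.card * (2 * r + T.card))) = 4 * c * r + 2 * c * T.card := by
          ring
        omega)
    refine le_trans (Nat.mul_le_mul_right _ (Set.ncard_le_ncard (X.words_mono M ?_))) hU
    exact fun x hx => ⟨hx.1, fun s hs => hx.2 s (hUM s hs).1 (hUM s hs).2⟩
  have hHc : H.card * C ^ r < (C + 1) ^ r := by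
    refine lt_of_le_of_lt (Nat.mul_le_mul_right _ ?_) hr
    calc H.card ≤ (R * M⁻¹).card := Finset.card_le_card (Finset.erase_subset _ _)
      _ ≤ R.card * M.card := by simpa using Finset.card_mul_le (s := R) (t := M⁻¹)
      _ ≤ R.card * (E.card * J.card * (8 * c * r + (4 * c * T.card + 3)) ^ 2) := by gcongr
      _ = _ := by ring
  have hWpos : 0 < W.ncard := by
    rw [Set.ncard_pos]
    exact ⟨_, x₁, fun _ _ => rfl, rfl⟩
  -- Union bound: the bad words for all `h ∈ H` together are fewer than `W`.
  obtain ⟨w, ⟨x₂, hx₂, rfl⟩, hw⟩ : ∃ w ∈ W, ∀ h ∈ H, w ∉ bad h := by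
    by_contra! hcon
    have hsub : W ⊆ ⋃ h ∈ H, bad h := by
      intro w hw
      obtain ⟨h, hh, hwh⟩ := hcon w hw
      exact Set.mem_biUnion hh hwh
    have h1 : W.ncard ≤ ∑ h ∈ H, (bad h).ncard :=
      (Set.ncard_le_ncard hsub).trans (Finset.set_ncard_biUnion_le H bad)
    have h2 : W.ncard * (C + 1) ^ r ≤ W.ncard * (H.card * C ^ r) := by
      calc W.ncard * (C + 1) ^ r ≤ (∑ h ∈ H, (bad h).ncard) * (C + 1) ^ r := by gcongr
        _ = ∑ h ∈ H, (bad h).ncard * (C + 1) ^ r := Finset.sum_mul ..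
        _ ≤ ∑ h ∈ H, W.ncard * C ^ r := Finset.sum_le_sum hbad
        _ = _ := by rw [Finset.sum_const, smul_eq_mul]; ring
    exact absurd (Nat.le_of_mul_le_mul_left h2 hWpos) (not_le.2 hHc)
  refine ⟨M, x₂, hTM, hx₂, fun a ha m hm ham => ?_⟩
  by_contra! hcon
  refine hw (a * m⁻¹) (Finset.mem_erase.2 ⟨fun h => ham (mul_inv_eq_one.1 h),
    Finset.mul_mem_mul ha (Finset.inv_mem_inv hm)⟩) ⟨x₂, ⟨hx₂, hcon⟩, rfl⟩

end Marker

/-! ### The swap automorphism of a marker pair -/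

section Swap

variable {A : Type*} [TopologicalSpace A] {G : Type*} [Group G]

/-- `p` occurs in `x` on `g M`. -/
def OccursOn (M : Finset G) (p x : G → A) (g : G) : Prop := ∀ t ∈ M, x (g * t) = p t

/-- Two points which differ only on `D`, can be exchanged for one another wherever they occur on
a translate of `M`, and whose occurrences on translates of `M` are `R`-separated. -/
structure MarkerPair (X : MulSubshift A G) (D R M : Finset G) where
  /-- The two points. -/
  pt : Bool → X.carrier
  subset_left : D ⊆ R
  subset_right : D ⊆ M
  eq_off : ∀ i j : Bool, ∀ h ∉ D, (pt i).1 h = (pt j).1 h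
  ne : pt false ≠ pt true
  separated : ∀ (x : G → A) (i j : Bool) (g g' : G), OccursOn M (pt i).1 x g →
    OccursOn M (pt j).1 x g' → ∀ r ∈ R, ∀ m ∈ M, g * r = g' * m → g = g'
  exchange : ∀ (x : X.carrier) (i j : Bool), OccursOn M (pt i).1 x.1 1 →
    replaceOn D (pt j).1 x.1 ∈ X.carrier

namespace MarkerPair

variable {X : MulSubshift A G} {D R M : Finset G} (P : MarkerPair X D R M)

include P in
theorem separated' {x : G → A} {i j : Bool} {g g' d m : G} (h : OccursOn M (P.pt i).1 x g)
    (h' : OccursOn M (P.pt j).1 x g') (hd : d ∈ D) (hm : m ∈ M) (e : g * d = g' * m) : g = g' :=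
  P.separated x i j g g' h h' d (P.subset_left hd) m hm e

theorem exists_ne : ∃ d ∈ D, (P.pt false).1 d ≠ (P.pt true).1 d := by
  by_contra! h
  refine P.ne (Subtype.ext (funext fun d => ?_))
  by_cases hd : d ∈ D
  · exact h d hd
  · exact P.eq_off _ _ d hd

theorem index_eq {x : G → A} {i j : Bool} {g : G} (h : OccursOn M (P.pt i).1 x g)
    (h' : OccursOn M (P.pt j).1 x g) : i = j := by
  obtain ⟨d, hd, hne⟩ := P.exists_ne
  have := (h d (P.subset_right hd)).symm.trans (h' d (P.subset_right hd))
  cases i <;> cases j <;> first | rfl | exact absurd this hne | exact absurd this.symm hne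

open Classical in
/-- Exchange the two patterns of a marker pair at all their occurrences. -/
noncomputable def swap (x : G → A) (k : G) : A :=
  if h : ∃ (g : G) (i : Bool), OccursOn M (P.pt i).1 x g ∧ g⁻¹ * k ∈ D then
    (P.pt !h.choose_spec.choose).1 (h.choose⁻¹ * k) else x k

theorem swap_of_mem {x : G → A} {g d : G} {i : Bool} (h : OccursOn M (P.pt i).1 x g)
    (hd : d ∈ D) : P.swap x (g * d) = (P.pt !i).1 d := by
  have hex : ∃ (g' : G) (i : Bool), OccursOn M (P.pt i).1 x g' ∧ g'⁻¹ * (g * d) ∈ D :=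
    ⟨g, i, h, by simpa using hd⟩
  obtain ⟨g', i', h', hd', e⟩ : ∃ (g' : G) (i' : Bool), OccursOn M (P.pt i').1 x g' ∧
      g'⁻¹ * (g * d) ∈ D ∧ P.swap x (g * d) = (P.pt !i').1 (g'⁻¹ * (g * d)) :=
    ⟨_, _, hex.choose_spec.choose_spec.1, hex.choose_spec.choose_spec.2, dif_pos hex⟩
  obtain rfl : g = g' := P.separated' h h' hd (P.subset_right hd') (by simp)
  rw [e, P.index_eq h h', inv_mul_cancel_left]

theorem swap_of_forall_notMem {x : G → A} {k : G}
    (h : ∀ (g : G) (i : Bool), OccursOn M (P.pt i).1 x g → g⁻¹ * k ∉ D) : P.swap x k = x k :=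
  dif_neg fun ⟨g, i, hg, hk⟩ => h g i hg hk

theorem swap_of_notMem {x : G → A} {g m : G} {i : Bool} (h : OccursOn M (P.pt i).1 x g)
    (hm : m ∈ M) (hmD : m ∉ D) : P.swap x (g * m) = x (g * m) := by
  refine P.swap_of_forall_notMem fun g' j h' hd => hmD ?_
  have := P.separated' h' h hd hm (by simp)
  simpa [this] using hd

theorem occursOn_swap {x : G → A} {g : G} {i : Bool} (h : OccursOn M (P.pt i).1 x g) :
    OccursOn M (P.pt !i).1 (P.swap x) g := by
  intro t ht
  by_cases hD : t ∈ D
  · exact P.swap_of_mem h hD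
  · rw [P.swap_of_notMem h ht hD, h t ht]
    exact P.eq_off _ _ t hD

/-- No occurrence is created. If an exchanged block meets `g M`, separation puts it at `g`.
Otherwise `g M` was untouched, so the pattern was already in `x` and its own block meets `g M`,
which is absurd. -/
theorem occursOn_of_swap {x : G → A} {g : G} {i : Bool}
    (h : OccursOn M (P.pt i).1 (P.swap x) g) : OccursOn M (P.pt !i).1 x g := by
  by_cases hex : ∃ (g' : G) (j : Bool), OccursOn M (P.pt j).1 x g' ∧ ∃ t ∈ M, g'⁻¹ * (g * t) ∈ D
  · obtain ⟨g', j, h', t, ht, hd⟩ := hex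
    have hs := P.occursOn_swap h'
    obtain rfl : g' = g := P.separated' hs h hd ht (by simp)
    obtain rfl := P.index_eq hs h
    simpa using h'
  · push Not at hex
    have hx : OccursOn M (P.pt i).1 x g := fun t ht => by
      rw [← h t ht, P.swap_of_forall_notMem fun g' j h' => hex g' j h' t ht]
    obtain ⟨d, hd, -⟩ := P.exists_ne
    exact absurd (by simpa using hd) (hex g i hx d (P.subset_right hd))

theorem swap_swap (x : G → A) : P.swap (P.swap x) = x := by
  funext k
  by_cases hex : ∃ (g : G) (i : Bool), OccursOn M (P.pt i).1 x g ∧ g⁻¹ * k ∈ D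
  · obtain ⟨g, i, h, hd⟩ := hex
    have := P.swap_of_mem (P.occursOn_swap h) hd
    rw [mul_inv_cancel_left] at this
    rw [this, Bool.not_not, ← h _ (P.subset_right hd), mul_inv_cancel_left]
  · push Not at hex
    rw [P.swap_of_forall_notMem fun g i h => hex g _ (P.occursOn_of_swap h),
      P.swap_of_forall_notMem hex]

theorem swap_mulShift (a : G) (x : G → A) : P.swap (mulShift a x) = mulShift a (P.swap x) := by
  have hocc : ∀ g i, OccursOn M (P.pt i).1 (mulShift a x) g ↔ OccursOn M (P.pt i).1 x (a * g) := by
    intro g i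
    simp only [OccursOn, mulShift_apply, mul_assoc]
  funext k
  rw [mulShift_apply]
  by_cases hex : ∃ (g : G) (i : Bool), OccursOn M (P.pt i).1 (mulShift a x) g ∧ g⁻¹ * k ∈ D
  · obtain ⟨g, i, h, hd⟩ := hex
    have h1 := P.swap_of_mem h hd
    have h2 := P.swap_of_mem ((hocc g i).1 h) hd
    rw [mul_inv_cancel_left] at h1
    rw [mul_assoc, mul_inv_cancel_left] at h2
    rw [h1, h2]
  · push Not at hex
    rw [P.swap_of_forall_notMem hex, P.swap_of_forall_notMem, mulShift_apply]
    intro g i h hd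
    refine hex (a⁻¹ * g) i ((hocc _ _).2 (by simpa using h)) ?_
    simpa [mul_assoc] using hd

/-- `exchange` handles one occurrence at a time. The induction can continue because, by separation,
earlier exchanges leave the remaining occurrences intact. -/
theorem exists_partial_swap (x : X.carrier) (O : Finset G) :
    ∃ z : X.carrier, ∀ k : G,
      ((∃ g ∈ O, ∃ i : Bool, OccursOn M (P.pt i).1 x.1 g ∧ g⁻¹ * k ∈ D) → z.1 k = P.swap x.1 k) ∧
      ((∀ g ∈ O, ∀ i : Bool, OccursOn M (P.pt i).1 x.1 g → g⁻¹ * k ∉ D) → z.1 k = x.1 k) := by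
  classical
  induction O using Finset.induction_on with
  | empty => exact ⟨x, fun k => ⟨by simp, fun _ => rfl⟩⟩
  | insert g O hg ih =>
    obtain ⟨z, hz⟩ := ih
    by_cases hex : ∃ i : Bool, OccursOn M (P.pt i).1 x.1 g
    · obtain ⟨i, hi⟩ := hex
      have hzi : OccursOn M (P.pt i).1 z.1 g := by
        intro t ht
        rw [← hi t ht]
        refine (hz _).2 fun g' hg' j h' hd => hg ?_
        rwa [← P.separated' h' hi hd ht (by simp)]
      obtain ⟨w, hw⟩ : ∃ w : X.carrier, ∀ k : G,
          w.1 k = replaceOn D (P.pt !i).1 (mulShift g z.1) (g⁻¹ * k) := by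
        refine ⟨⟨_, X.mapsTo g⁻¹ (P.exchange ⟨mulShift g z.1, X.mapsTo g z.2⟩ i (!i) ?_)⟩,
          fun _ => rfl⟩
        intro t ht
        rw [one_mul]
        exact hzi t ht
      refine ⟨w, fun k => ?_⟩
      rw [hw]
      by_cases hk : g⁻¹ * k ∈ D
      · rw [replaceOn_of_mem hk]
        refine ⟨fun _ => ?_, fun h => absurd hk (h g (Finset.mem_insert_self _ _) i hi)⟩
        have := P.swap_of_mem hi hk
        rw [mul_inv_cancel_left] at this
        exact this.symm
      · rw [replaceOn_of_notMem hk, mulShift_apply, mul_inv_cancel_left]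
        refine ⟨?_, fun h => (hz k).2 fun g' hg' => h g' (Finset.mem_insert_of_mem hg')⟩
        rintro ⟨g', hg', j, hj, hd⟩
        rcases Finset.mem_insert.1 hg' with rfl | hg'
        · exact absurd hd hk
        · exact (hz k).1 ⟨g', hg', j, hj, hd⟩
    · refine ⟨z, fun k => ⟨?_, fun h =>
        (hz k).2 fun g' hg' => h g' (Finset.mem_insert_of_mem hg')⟩⟩
      rintro ⟨g', hg', j, hj, hd⟩
      rcases Finset.mem_insert.1 hg' with rfl | hg'
      · exact absurd ⟨j, hj⟩ hex
      · exact (hz k).1 ⟨g', hg', j, hj, hd⟩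

theorem swap_mem [DiscreteTopology A] (x : X.carrier) : P.swap x.1 ∈ X.carrier := by
  classical
  refine X.mem_carrier_of_forall_finset _ fun F => ?_
  -- Only occurrences at points of `F D⁻¹` can affect letters in `F`.
  obtain ⟨z, hz⟩ := P.exists_partial_swap x (F * D⁻¹)
  refine ⟨z.1, z.2, fun k hk => ?_⟩
  by_cases hex : ∃ (g : G) (i : Bool), OccursOn M (P.pt i).1 x.1 g ∧ g⁻¹ * k ∈ D
  · obtain ⟨g, i, h, hd⟩ := hex
    refine (hz k).1 ⟨g, ?_, i, h, hd⟩
    exact Finset.mem_mul.2 ⟨k, hk, _, Finset.inv_mem_inv hd, by simp⟩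
  · push Not at hex
    rw [P.swap_of_forall_notMem hex]
    exact (hz k).2 fun g _ => hex g

theorem swap_congr [DecidableEq G] {x y : G → A} {k : G} (hk : x k = y k)
    (h : ∀ t ∈ D⁻¹ * M, x (k * t) = y (k * t)) : P.swap x k = P.swap y k := by
  have hocc : ∀ g i, g⁻¹ * k ∈ D →
      (OccursOn M (P.pt i).1 x g ↔ OccursOn M (P.pt i).1 y g) := by
    intro g i hd
    refine forall₂_congr fun t ht => ?_
    have := h _ (Finset.mul_mem_mul (Finset.inv_mem_inv hd) ht)
    rw [mul_inv_rev, inv_inv, mul_assoc, mul_inv_cancel_left] at this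
    rw [this]
  by_cases hex : ∃ (g : G) (i : Bool), OccursOn M (P.pt i).1 x g ∧ g⁻¹ * k ∈ D
  · obtain ⟨g, i, hx, hd⟩ := hex
    have h1 := P.swap_of_mem hx hd
    have h2 := P.swap_of_mem ((hocc g i hd).1 hx) hd
    rw [mul_inv_cancel_left] at h1 h2
    rw [h1, h2]
  · push Not at hex
    rw [P.swap_of_forall_notMem hex, hk, P.swap_of_forall_notMem]
    exact fun g i hy hd => hex g i ((hocc g i hd).2 hy) hd

/-- The exchange of a marker pair as an automorphism of the subshift. -/
noncomputable def swapAut [Finite A] [DiscreteTopology A] : X.Aut where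
  val :=
    have hc : Continuous fun x : X.carrier => (⟨P.swap x.1, P.swap_mem x⟩ : X.carrier) := by
      classical
      refine X.continuous_of_determines fun k =>
        ⟨insert k ((D⁻¹ * M).image (k * ·)), fun x y h => ?_⟩
      exact P.swap_congr (h k (Finset.mem_insert_self _ _)) fun t ht =>
        h _ (Finset.mem_insert_of_mem (Finset.mem_image_of_mem _ ht))
    { toFun := fun x => ⟨P.swap x.1, P.swap_mem x⟩
      invFun := fun x => ⟨P.swap x.1, P.swap_mem x⟩
      left_inv := fun x => Subtype.ext (P.swap_swap x.1)
      right_inv := fun x => Subtype.ext (P.swap_swap x.1)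
      continuous_toFun := hc
      continuous_invFun := hc }
  property := fun g x => Subtype.ext (P.swap_mulShift g⁻¹ x.1)

theorem swapAut_apply [Finite A] [DiscreteTopology A] (x : X.carrier) :
    (P.swapAut.1 x).1 = P.swap x.1 := rfl

end MarkerPair

end Swap

/-! ### The center of the automorphism group -/

section Center

variable {A : Type*} [TopologicalSpace A] {G : Type*} [Group G]

/-- The exchangeable frame `T ⊇ K` comes first and the marker extends it. Overlaps are refuted on `M
\ T`, where both points agree, so self-overlaps and mixed overlaps are excluded together. -/
theorem exists_markerPair [Infinite G] [Finite A] [DiscreteTopology A] {X : MulSubshift A G}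
    (hX : X.IsFaithful) {K : Finset G} (h1K : 1 ∈ K) (hK : X.GluesWith K) {R : Finset G}
    (hKR : K ⊆ R) (F : Finset G) (x₀ : X.carrier) :
    ∃ (M : Finset G) (P : X.MarkerPair K R M), F ⊆ M ∧
      ∀ i, ∀ h ∈ F, h ∉ K → (P.pt i).1 h = x₀.1 h := by
  classical
  obtain ⟨T, x₁, hFT, hKT, hx₁, hT⟩ := X.exists_exchangeable K F x₀
  obtain ⟨M, x₂, hTM, hx₂, hM⟩ := exists_marker hX h1K hK R T x₁
  obtain ⟨u, v, huv⟩ := exists_apply_one_ne hX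
  have hfill : ∀ w : X.carrier, ∃ y : X.carrier, y.1 1 = w.1 1 ∧
      ∀ h ∈ M, h ∉ K → y.1 h = x₂.1 h := by
    intro w
    obtain ⟨y, hy1, hy2⟩ := hK {1} (M \ K) (fun s hs k hk hsk => by
      rw [Finset.mem_singleton.1 hs, one_mul] at hsk
      exact (Finset.mem_sdiff.1 hsk).2 hk) w x₂
    exact ⟨y, hy1 1 (Finset.mem_singleton_self _), fun h hh hhK =>
      hy2 h (Finset.mem_sdiff.2 ⟨hh, hhK⟩)⟩
  obtain ⟨y₀, hy₀1, hy₀⟩ := hfill u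
  obtain ⟨y₁, hy₁1, hy₁⟩ := hfill v
  have hTx : ∀ y : X.carrier, (∀ h ∈ M, h ∉ K → y.1 h = x₂.1 h) →
      ∀ h ∈ T, h ∉ K → y.1 h = x₁.1 h := fun y hy h hh hhK => by
    rw [hy h (hTM hh) hhK, hx₂ h hh]
  -- `y₀` and `y₁` are only known to agree on `M \ K`; transplanting the filling of `y₁` into `y₀`
  -- gives agreement everywhere off `K`.
  let pt : Bool → X.carrier := fun b => bif b then ⟨_, hT y₀ y₁ (hTx _ hy₀) (hTx _ hy₁)⟩ else y₀
  have hoff : ∀ i, ∀ h ∉ K, (pt i).1 h = y₀.1 h := by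
    rintro (_ | _) h hh
    · rfl
    · exact replaceOn_of_notMem hh
  have hpt : ∀ i, ∀ h ∈ M, h ∉ K → (pt i).1 h = x₂.1 h := fun i h hh hhK => by
    rw [hoff i h hhK, hy₀ h hh hhK]
  refine ⟨M, ⟨pt, hKR, hKT.trans hTM, fun i j h hh => ?_, fun h => ?_, ?_, ?_⟩, hFT.trans hTM, ?_⟩
  · rw [hoff i h hh, hoff j h hh]
  · apply huv
    rw [← hy₀1, ← hy₁1, show y₀ = _ from h]
    exact replaceOn_of_mem h1K
  · intro x i j g g' hg hg' r hr m hm e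
    by_contra hne
    have hrm : g' = g * (r * m⁻¹) := by rw [← mul_assoc, e, mul_inv_cancel_right]
    obtain ⟨t, ht, ht', hx⟩ := hM r hr m hm (fun h => hne (by simpa [h] using hrm.symm))
    rw [Finset.mem_sdiff] at ht ht'
    apply hx
    rw [← hpt i t ht.1 (fun h => ht.2 (hKT h)), ← hg t ht.1,
      ← hpt j _ ht'.1 (fun h => ht'.2 (hKT h)), ← hg' _ ht'.1, hrm]
    simp [mul_assoc]
  · intro x i j hx
    refine hT x (pt j) (fun h hh hhK => ?_) (hTx _ (hpt j))
    have := hx h (hTM hh)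
    rw [one_mul] at this
    rw [this, hTx _ (hpt i) h hh hhK]
  · intro i h hh hhK
    rw [hTx _ (hpt i) h (hFT hh) hhK, hx₁ h hh hhK]

/-- If `φ` is not a shift, then finitely many letters far away from `D` can witness that `φ` does
not act as the shift by any element of a given finite set. -/
theorem exists_finset_forall_apply_ne [Infinite G] {X : MulSubshift A G} (hX : X.IsFaithful)
    {K : Finset G} (hK : X.GluesWith K) {φ : X.carrier → X.carrier} {m : Finset G}
    (hφ : X.HasMemory φ m)
    (hφG : ∀ (g : G) (x : X.carrier), φ (X.leftShift g x) = X.leftShift g (φ x))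
    (hne : ∀ k : G, ∃ x : X.carrier, φ x ≠ X.leftShift k x) (D Q : Finset G) :
    ∃ (F : Finset G) (x₀ : X.carrier), Disjoint F D ∧ ∀ x : X.carrier,
      (∀ h ∈ F, x.1 h = x₀.1 h) → ∀ g ∈ Q, ∃ t ∈ F, (φ x).1 (g * t) ≠ x.1 t := by
  classical
  obtain ⟨J, hJ⟩ := exists_finset_apply_ne hK (exists_apply_one_ne hX) hφ
  have hne' : ∀ k : G, ∃ j ∈ J, ∃ x : X.carrier, (φ x).1 (k * j) ≠ x.1 j := by
    intro k
    refine hJ k ?_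
    by_contra! hcon
    obtain ⟨x, hx⟩ := hne k
    refine hx (Subtype.ext (funext fun h => ?_))
    simpa [leftShift_apply] using hcon (k⁻¹ * h) x
  induction Q using Finset.induction_on with
  | empty =>
    obtain ⟨x, -⟩ := hne 1
    exact ⟨∅, x, by simp, by simp⟩
  | insert g Q hg ih =>
    obtain ⟨F, x₀, hFD, hF⟩ := ih
    set B : Finset G := D ∪ F * K⁻¹ with hB
    -- Since `J` does not depend on the conjugate `t⁻¹ g t`, one can first move `t` far enough for
    -- every `j ∈ J`, and only then pick the witness `j`.
    obtain ⟨t, ht⟩ := Infinite.exists_notMem_finset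
      (B * J⁻¹ ∪ ({g⁻¹} : Finset G) * B * m⁻¹ * J⁻¹)
    obtain ⟨j, hj, u, hu⟩ := hne' (t⁻¹ * g * t)
    set S : Finset G := insert (t * j) (m.image (g * (t * j) * ·)) with hS
    have hSB : ∀ s ∈ S, s ∉ B := by
      intro s hs hsB
      refine ht ?_
      rcases Finset.mem_insert.1 hs with rfl | hs
      · exact Finset.mem_union_left _ (Finset.mem_mul.2 ⟨_, hsB, _, Finset.inv_mem_inv hj, by simp⟩)
      · obtain ⟨c, hc, rfl⟩ := Finset.mem_image.1 hs
        have := Finset.mul_mem_mul (Finset.mul_mem_mul (Finset.mul_mem_mul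
          (Finset.mem_singleton_self g⁻¹) hsB) (Finset.inv_mem_inv hc)) (Finset.inv_mem_inv hj)
        refine Finset.mem_union_right _ ?_
        convert this using 1
        group
    obtain ⟨z, hzS, hzF⟩ := hK S F (fun s hs k hk hsk => hSB s hs
      (Finset.mem_union_right _ (Finset.mem_mul.2 ⟨_, hsk, _, Finset.inv_mem_inv hk, by simp⟩)))
      (X.leftShift t u) x₀
    refine ⟨S ∪ F, z, ?_, fun x hx g' hg' => ?_⟩
    · refine Finset.disjoint_union_left.2 ⟨Finset.disjoint_left.2 fun s hs hsD => ?_, hFD⟩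
      exact hSB s hs (Finset.mem_union_left _ hsD)
    · rcases Finset.mem_insert.1 hg' with rfl | hg'
      · have hxS : ∀ s ∈ S, x.1 s = (X.leftShift t u).1 s := fun s hs => by
          rw [hx s (Finset.mem_union_left _ hs), hzS s hs]
        refine ⟨t * j, Finset.mem_union_left _ (Finset.mem_insert_self _ _), ?_⟩
        rw [hxS _ (Finset.mem_insert_self _ _), hφ _ x (X.leftShift t u) fun c hc =>
          hxS _ (Finset.mem_insert_of_mem (Finset.mem_image_of_mem _ hc)), hφG]
        simpa [leftShift_apply, mul_assoc] using hu
      · obtain ⟨s, hs, hne⟩ := hF x (fun h hh => by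
          rw [hx h (Finset.mem_union_right _ hh), hzF h hh]) g' hg'
        exact ⟨s, Finset.mem_union_right _ hs, hne⟩

/-- The center of the automorphism group of a faithful strongly irreducible subshift over an
infinite group consists of shifts. -/
theorem exists_eq_leftShift_of_mem_center [Infinite G] [Finite A] [DiscreteTopology A]
    {X : MulSubshift A G} (hX : X.IsFaithful) (hsi : X.IsStronglyIrreducible) {φ : X.Aut}
    (hφ : φ ∈ Subgroup.center X.Aut) : ∃ k : G, ∀ x : X.carrier, φ.1 x = X.leftShift k x := by
  classical
  by_contra! hne
  obtain ⟨K, h1K, hK⟩ := hsi.exists_gluesWith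
  obtain ⟨m, hm⟩ := X.exists_hasMemory φ.1.continuous φ.2
  -- `φ y₀` and `φ y₁` can differ only on `K m⁻¹`, and an occurrence whose block meets this set lies
  -- in `K m⁻¹ K⁻¹`. The set `R` below makes `1` the only occurrence in `y₀` whose block meets `K
  -- m⁻¹ m`.
  obtain ⟨F, x₀, hFK, hF⟩ := exists_finset_forall_apply_ne hX hK hm φ.2 hne K (K * m⁻¹ * K⁻¹)
  obtain ⟨M, P, hFM, hP⟩ := exists_markerPair hX h1K hK
    (R := K ∪ K * m⁻¹ * m * K⁻¹) Finset.subset_union_left F x₀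
  set y₀ := P.pt false
  set y₁ := P.pt true
  have hocc : OccursOn M y₀.1 y₀.1 1 := fun t _ => by rw [one_mul]
  have hswap : ∀ p ∈ K * m⁻¹ * m, P.swap y₀.1 p = y₁.1 p := by
    intro p hp
    by_cases hpK : p ∈ K
    · simpa using P.swap_of_mem hocc hpK
    · rw [P.swap_of_forall_notMem, P.eq_off false true p hpK]
      intro g i hg hgp
      have hgR : g ∈ K ∪ K * m⁻¹ * m * K⁻¹ := Finset.mem_union_right _
        (Finset.mem_mul.2 ⟨p, hp, _, Finset.inv_mem_inv hgp, by simp⟩)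
      have := P.separated _ _ _ _ _ hocc hg g hgR 1 (P.subset_right h1K) (by simp)
      rw [← this] at hgp
      exact hpK (by simpa using hgp)
  -- Centrality enters here. The swap of `y₀` need not be `y₁` globally, but they agree on the
  -- memory window of `p`.
  have hφswap : ∀ p ∈ K * m⁻¹, P.swap (φ.1 y₀).1 p = (φ.1 y₁).1 p := by
    intro p hp
    have hcomm : P.swapAut.1 (φ.1 y₀) = φ.1 (P.swapAut.1 y₀) :=
      DFunLike.congr_fun (congrArg Subtype.val (Subgroup.mem_center_iff.1 hφ P.swapAut)) y₀
    rw [← P.swapAut_apply, hcomm]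
    exact hm p _ _ fun t ht => hswap _ (Finset.mul_mem_mul hp ht)
  obtain ⟨p, hp, hne⟩ : ∃ p ∈ K * m⁻¹, (φ.1 y₀).1 p ≠ (φ.1 y₁).1 p := by
    by_contra! hcon
    refine P.ne (φ.1.injective (Subtype.ext (funext fun p => ?_)))
    by_cases hp : p ∈ K * m⁻¹
    · exact hcon p hp
    · refine hm p _ _ fun t ht => P.eq_off _ _ _ fun hpt => hp ?_
      exact Finset.mem_mul.2 ⟨_, hpt, _, Finset.inv_mem_inv ht, by simp⟩
  obtain ⟨g, i, hg, hgp⟩ : ∃ (g : G) (i : Bool),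
      OccursOn M (P.pt i).1 (φ.1 y₀).1 g ∧ g⁻¹ * p ∈ K := by
    by_contra! hcon
    exact hne (by rw [← hφswap p hp, P.swap_of_forall_notMem hcon])
  obtain ⟨t, ht, htne⟩ := hF y₀ (fun h hh => hP _ h hh (Finset.disjoint_left.1 hFK hh)) g
    (Finset.mem_mul.2 ⟨p, hp, _, Finset.inv_mem_inv hgp, by simp⟩)
  apply htne
  rw [hg t (hFM ht)]
  exact P.eq_off _ _ t (Finset.disjoint_left.1 hFK ht)

/-- The action of a central element of `G`, as an automorphism. -/
def centerShift [DiscreteTopology A] (X : MulSubshift A G) : Subgroup.center G →* X.Aut where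
  toFun k := ⟨
    { toFun := X.leftShift k
      invFun := X.leftShift k⁻¹
      left_inv := fun x => by rw [← leftShift_mul, inv_mul_cancel, leftShift_one]
      right_inv := fun x => by rw [← leftShift_mul, mul_inv_cancel, leftShift_one]
      continuous_toFun :=
        ((continuous_mulShift _).comp continuous_subtype_val).subtype_mk _
      continuous_invFun :=
        ((continuous_mulShift _).comp continuous_subtype_val).subtype_mk _ },
    fun g x => by
      change X.leftShift k (X.leftShift g x) = X.leftShift g (X.leftShift k x)
      rw [← leftShift_mul, ← leftShift_mul, Subgroup.mem_center_iff.1 k.2 g]⟩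
  map_one' := Subtype.ext (Homeomorph.ext fun x => X.leftShift_one x)
  map_mul' k l := Subtype.ext (Homeomorph.ext fun x => X.leftShift_mul k l x)

theorem centerShift_apply [DiscreteTopology A] (X : MulSubshift A G) (k : Subgroup.center G)
    (x : X.carrier) : (X.centerShift k).1 x = X.leftShift k x := rfl

theorem centerShift_injective [DiscreteTopology A] {X : MulSubshift A G} (hX : X.IsFaithful) :
    Function.Injective X.centerShift := by
  refine (injective_iff_map_eq_one _).2 fun k hk => Subtype.ext ?_
  have hfix : (k : G) ∈ X.Fix := fun x => by
    rw [← centerShift_apply, hk]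
    rfl
  rwa [show X.Fix = ⊥ from hX, Subgroup.mem_bot] at hfix

/-- Equivariance makes central shifts commute with `Aut X`. Conversely, a central automorphism is
the shift by some `k`; its equivariance and faithfulness force `k` to be central. -/
theorem range_centerShift [Infinite G] [Finite A] [DiscreteTopology A] {X : MulSubshift A G}
    (hX : X.IsFaithful) (hsi : X.IsStronglyIrreducible) :
    X.centerShift.range = Subgroup.center X.Aut := by
  refine le_antisymm ?_ fun φ hφ => ?_
  · rintro _ ⟨k, rfl⟩
    refine Subgroup.mem_center_iff.2 fun ψ => Subtype.ext (Homeomorph.ext fun x => ?_)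
    exact ψ.2 k x
  · obtain ⟨k, hk⟩ := exists_eq_leftShift_of_mem_center hX hsi hφ
    have hkc : k ∈ Subgroup.center G := by
      refine Subgroup.mem_center_iff.2 fun g => ?_
      have hfix : (g * k)⁻¹ * (k * g) ∈ X.Fix := fun x => by
        rw [leftShift_mul, leftShift_mul, ← hk, φ.2, hk, ← leftShift_mul, ← leftShift_mul,
          mul_assoc, inv_mul_cancel, leftShift_one]
      rw [show X.Fix = ⊥ from hX, Subgroup.mem_bot, inv_mul_eq_one] at hfix
      exact hfix
    exact ⟨⟨k, hkc⟩, Subtype.ext (Homeomorph.ext fun x => (hk x).symm)⟩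

/-- Ryan's theorem: the center of the automorphism group is the center of the group. -/
theorem nonempty_center_mulEquiv [Infinite G] [Finite A] [DiscreteTopology A] {X : MulSubshift A G}
    (hX : X.IsFaithful) (hsi : X.IsStronglyIrreducible) :
    Nonempty (Subgroup.center G ≃* Subgroup.center X.Aut) :=
  ⟨(MonoidHom.ofInjective (centerShift_injective hX)).trans
    (MulEquiv.subgroupCongr (range_centerShift hX hsi))⟩

theorem nonempty_center_mulEquiv_of_aut [Infinite G] [Finite A] [DiscreteTopology A]
    {H B : Type*} [Group H] [Infinite H] [Finite B] [TopologicalSpace B] [DiscreteTopology B]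
    {X : MulSubshift A G} {Y : MulSubshift B H} (hX : X.IsFaithful)
    (hX' : X.IsStronglyIrreducible) (hY : Y.IsFaithful) (hY' : Y.IsStronglyIrreducible)
    (h : Nonempty (X.Aut ≃* Y.Aut)) : Nonempty (Subgroup.center G ≃* Subgroup.center H) := by
  obtain ⟨e⟩ := h
  obtain ⟨eX⟩ := nonempty_center_mulEquiv hX hX'
  obtain ⟨eY⟩ := nonempty_center_mulEquiv hY hY'
  exact ⟨(eX.trans (Subgroup.centerCongr e)).trans eY.symm⟩

theorem isFaithful_mulFullShift [Nontrivial A] : (mulFullShift A G).IsFaithful := by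
  classical
  refine (Subgroup.eq_bot_iff_forall _).2 fun g hg => ?_
  by_contra hne
  obtain ⟨a, b, hab⟩ := exists_pair_ne A
  have h := congrFun (congrArg Subtype.val (hg ⟨fun h => if h = 1 then a else b, trivial⟩)) 1
  rw [leftShift_apply] at h
  simp [hne, hab.symm] at h

theorem isStronglyIrreducible_mulFullShift : (mulFullShift A G).IsStronglyIrreducible := by
  classical
  refine ⟨{1}, fun S T hST p ⟨x, g, hp⟩ q ⟨y, k, hq⟩ => ?_⟩
  refine ⟨⟨fun h => if h ∈ S then x.1 (g * h) else y.1 (k * h), trivial⟩,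
    fun h => ?_, fun h => ?_⟩
  · rw [← hp h, leftShift_apply, inv_inv]
    exact if_pos h.2
  · rw [← hq h, leftShift_apply, inv_inv]
    refine if_neg fun hS => Set.disjoint_left.1 hST ?_ h.2
    simpa using hS

end Center

end SymbolicDynamics.FullShift.MulSubshift

/-- The groups are abelian, so the centers are everything, and the rank of a free `ℤ`-module is an
invariant. -/
theorem eq_of_center_multiplicative_mulEquiv {m n : ℕ}
    (e : Subgroup.center (Multiplicative (Fin m → ℤ)) ≃*
      Subgroup.center (Multiplicative (Fin n → ℤ))) : m = n := by
  have e' : Multiplicative (Fin m → ℤ) ≃* Multiplicative (Fin n → ℤ) :=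
    ((Subgroup.topEquiv.symm.trans (MulEquiv.subgroupCongr CommGroup.center_eq_top.symm)).trans
      e).trans ((MulEquiv.subgroupCongr CommGroup.center_eq_top).trans Subgroup.topEquiv)
  simpa using card_eq_of_linearEquiv ℤ (AddEquiv.toMultiplicative.symm e').toIntLinearEquiv

theorem mainTheorem7 :
    (∀ (G : Type u) [Group G] [Infinite G] (H : Type v) [Group H] [Infinite H]
        (A : Type w) [Finite A] [TopologicalSpace A] [DiscreteTopology A]
        (B : Type z) [Finite B] [TopologicalSpace B] [DiscreteTopology B]
        (X : MulSubshift A G) (Y : MulSubshift B H),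
        X.IsFaithful → X.IsStronglyIrreducible → Y.IsFaithful → Y.IsStronglyIrreducible →
        Nonempty (X.Aut ≃* Y.Aut) →
        Nonempty (Subgroup.center G ≃* Subgroup.center H)) ∧
    (∀ (G : Type u) [Group G] [Infinite G] (H : Type v) [Group H] [Infinite H]
        (A : Type w) [Finite A] [TopologicalSpace A] [DiscreteTopology A]
        (B : Type z) [Finite B] [TopologicalSpace B] [DiscreteTopology B],
        2 ≤ min (Nat.card A) (Nat.card B) →
        Nonempty ((mulFullShift A G).Aut ≃* (mulFullShift B H).Aut) →
        Nonempty (Subgroup.center G ≃* Subgroup.center H)) ∧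
    (∀ m n : ℕ, 0 < m → 0 < n → m ≠ n →
        ¬ Nonempty ((mulFullShift (Fin 2) (Multiplicative (Fin m → ℤ))).Aut ≃*
          (mulFullShift (Fin 2) (Multiplicative (Fin n → ℤ))).Aut)) := by
  refine ⟨?_, ?_, ?_⟩
  · intro G _ _ H _ _ A _ _ _ B _ _ _ X Y hX hX' hY hY' h
    exact MulSubshift.nonempty_center_mulEquiv_of_aut hX hX' hY hY' h
  · intro G _ _ H _ _ A _ _ _ B _ _ _ hAB h
    have : Nontrivial A := Finite.one_lt_card_iff_nontrivial.1 (le_min_iff.1 hAB).1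
    have : Nontrivial B := Finite.one_lt_card_iff_nontrivial.1 (le_min_iff.1 hAB).2
    exact MulSubshift.nonempty_center_mulEquiv_of_aut MulSubshift.isFaithful_mulFullShift
      MulSubshift.isStronglyIrreducible_mulFullShift MulSubshift.isFaithful_mulFullShift
      MulSubshift.isStronglyIrreducible_mulFullShift h
  · intro m n hm hn hmn h
    have : NeZero m := ⟨hm.ne'⟩
    have : NeZero n := ⟨hn.ne'⟩
    obtain ⟨e⟩ := MulSubshift.nonempty_center_mulEquiv_of_aut MulSubshift.isFaithful_mulFullShift
      MulSubshift.isStronglyIrreducible_mulFullShift MulSubshift.isFaithful_mulFullShift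
      MulSubshift.isStronglyIrreducible_mulFullShift h
    exact hmn (eq_of_center_multiplicative_mulEquiv e)
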